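/- Let $1<\alpha<\beta<\infty$, $\Omega=(-\infty,0)\cup(1,\alpha)\cup(\beta,\infty)$, $e(x)=e^{2\pi i x}$, and $e_\xi(x)=e(\xi x)$. For a unitary matrix $B=\begin{pmatrix}B_{11}&B_{12}\\B_{21}&B_{22}\end{pmatrix}\in U(2)$ let $P_B$ be the selfadjoint operator $\frac{1}{2\pi i}\frac{d}{dx}$ in $L^2(\Omega)$ with boundary condition $B\begin{pmatrix}f(1)\\f(\beta)\end{pmatrix}=\begin{pmatrix}f(0)\\f(\alpha)\end{pmatrix}$, and define a Borel measure $\sigma_B$ on $\mathbb R$ as follows. If $w:=|B_{11}|>0$, then for every $\lambda\in\mathbb R$ there are unique $a_B(\lambda),c_B(\lambda)\in\mathbb C$ such that $\psi_\lambda=(a_B(\lambda)\chi_{(-\infty,0)}+\chi_{(1,\alpha)}+c_B(\lambda)\chi_{(\beta,\infty)})\,e_\lambda$ satisfies this boundary condition, namely $$a_B(\lambda)=\overline{B_{11}}^{\,-1}e(\lambda)\bigl(1-\overline{B_{21}}\,e((\alpha-1)\lambda)\bigr),\qquad c_B(\lambda)=B_{22}^{-1}e(-(\beta-\alpha)\lambda)\bigl(1-B_{21}\,e(-(\alpha-1)\lambda)\bigr);$$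 they satisfy $|a_B|=|c_B|=:m_B$, and $\sigma_B(d\lambda):=m_B(\lambda)^{-2}\,d\lambda$. If $w=0$, then $\sigma_B$ is the mixture $d\lambda+\kappa\sum_{\xi\in\Lambda_B}\delta_\xi$ of Lebesgue measure and the Dirac comb on the embedded point spectrum $\Lambda_B=\{\xi\in\mathbb R: B_{21}e(\xi)=e(\alpha\xi)\}$ of $P_B$, with an arbitrary normalization $\kappa>0$. For a Borel measure $\mu$ on $\mathbb R$, the pair $(\Omega,\mu)$ is called a spectral pair if the map $f\mapsto\widehat f$, $\widehat f(\xi)=\int_\Omega f(x)e_\xi(x)\,dx$ (defined on $L^1(\Omega)\cap L^2(\Omega)$ and extended to $L^2(\Omega)$ by density), is a surjective isometry from $L^2(\Omega)$ onto $L^2(\mu)$. Proposition 3.23. For every $\kappa>0$ there is no unitary $2\times2$ matrix $B$ such that $(\Omega,\sigma_B)$ is a spectral pair. -/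

import Mathlib

open MeasureTheory
open scoped NNReal ComplexConjugate

noncomputable section

/-- The character `e(x) = exp(2πix)`; the exponential `e_ξ` is `x ↦ e(ξx)`. -/
def ePer (x : ℝ) : ℂ := Complex.exp (2 * Real.pi * Complex.I * x)

/-- The exterior domain `Ω = (-∞, 0) ∪ (1, α) ∪ (β, ∞)`, i.e. the complement of
`[0, 1] ∪ [α, β]`. -/
def exteriorDomain (α β : ℝ) : Set ℝ := Set.Iio 0 ∪ Set.Ioo 1 α ∪ Set.Ioi β

/-- `(Ω, μ)` is a spectral pair: the map `f ↦ (ξ ↦ ∫_Ω f(x) e_ξ(x) dx)` is a surjective linear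
isometry of `L²(Ω)` onto `L²(μ)`. As usual the integral is used on `L¹(Ω) ∩ L²(Ω)`, which is dense
in `L²(Ω)`, and so determines the map on all of `L²(Ω)`. -/
def IsSpectralPair (Ω : Set ℝ) (μ : Measure ℝ) : Prop :=
  ∃ F : Lp ℂ 2 (volume.restrict Ω) ≃ₗᵢ[ℂ] Lp ℂ 2 μ,
    ∀ f : Lp ℂ 2 (volume.restrict Ω), Integrable f (volume.restrict Ω) →
      F f =ᵐ[μ] fun ξ : ℝ => ∫ x in Ω, f x * ePer (ξ * x)

/-- The coefficient `a_B(ξ)` on `(-∞, 0)` of the generalized eigenfunction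
`ψ_ξ = (a_B(ξ) χ_{(-∞,0)} + χ_{(1,α)} + c_B(ξ) χ_{(β,∞)}) e_ξ` of the selfadjoint operator `P_B`
(for `B 0 0 ≠ 0`); see `boundary_condition_iff`. -/
def coeffA (α : ℝ) (B : Matrix (Fin 2) (Fin 2) ℂ) (ξ : ℝ) : ℂ :=
  (conj (B 0 0))⁻¹ * ePer ξ * (1 - conj (B 1 0) * ePer ((α - 1) * ξ))

/-- The coefficient `c_B(ξ)` on `(β, ∞)` of the generalized eigenfunction of `P_B`. -/
def coeffC (α β : ℝ) (B : Matrix (Fin 2) (Fin 2) ℂ) (ξ : ℝ) : ℂ :=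
  (B 1 1)⁻¹ * ePer (-(β - α) * ξ) * (1 - B 1 0 * ePer (-((α - 1) * ξ)))

/-- `m_B(ξ) = |a_B(ξ)|` (which is also `|c_B(ξ)|`, see `norm_coeffC`). -/
def mFun (α : ℝ) (B : Matrix (Fin 2) (Fin 2) ℂ) (ξ : ℝ) : ℝ := ‖coeffA α B ξ‖

/-- The embedded point spectrum of `P_B` when `B 0 0 = 0`: the `ξ` for which the function
`χ_{(1,α)} e_ξ` satisfies the boundary condition, `B 1 0 * e_ξ(1) = e_ξ(α)`. If `B 1 0 = e(ψ)` this
is the set `(ψ + ℤ) / (α - 1)`. -/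
def atomSet (α : ℝ) (B : Matrix (Fin 2) (Fin 2) ℂ) : Set ℝ :=
  {ξ | B 1 0 * ePer ξ = ePer (α * ξ)}

open Classical in
/-- The measure `σ_B`. With `w = |B 0 0|`: for `w > 0` it is `m_B(ξ)⁻² dξ`; for `w = 0` it is the
mixture of Lebesgue measure and the Dirac comb on the embedded point spectrum, each atom having
mass `κ`. (The value of `κ` is a normalization and plays no role when `w > 0`; the spectral
resolution of `P_B` has `κ = 1 / (α - 1)`.) -/
def sigmaMeasure (α : ℝ) (κ : ℝ≥0) (B : Matrix (Fin 2) (Fin 2) ℂ) : Measure ℝ :=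
  if B 0 0 = 0 then
    volume + κ • Measure.sum (fun ξ : atomSet α B => Measure.dirac (ξ : ℝ))
  else
    volume.withDensity (fun ξ => ENNReal.ofReal ((mFun α B ξ ^ 2)⁻¹))

theorem ePer_add (x y : ℝ) : ePer (x + y) = ePer x * ePer y := by
  simp only [ePer, ← Complex.exp_add]; congr 1; push_cast; ring

theorem ePer_ne_zero (x : ℝ) : ePer x ≠ 0 := Complex.exp_ne_zero _

theorem conj_ePer (x : ℝ) : conj (ePer x) = ePer (-x) := by
  simp [ePer, ← Complex.exp_conj, Complex.conj_ofNat]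

theorem norm_ePer (x : ℝ) : ‖ePer x‖ = 1 := by
  rw [ePer, show (2 * Real.pi * Complex.I * x : ℂ) = ((2 * Real.pi * x : ℝ) : ℂ) * Complex.I by
    push_cast; ring]
  exact Complex.norm_exp_ofReal_mul_I _

/-- The relations between the entries of a unitary matrix that are used below. -/
theorem unitary_entries {B : Matrix (Fin 2) (Fin 2) ℂ} (hB : B ∈ Matrix.unitaryGroup (Fin 2) ℂ) :
    conj (B 0 0) * B 0 0 + conj (B 1 0) * B 1 0 = 1 ∧
    conj (B 0 0) * B 0 1 + conj (B 1 0) * B 1 1 = 0 ∧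
    ‖B 0 0‖ = ‖B 1 1‖ := by
  have h1 := Matrix.mem_unitaryGroup_iff'.1 hB
  have h2 := Matrix.mem_unitaryGroup_iff.1 hB
  have e00 := congrFun (congrFun h1 0) 0
  have e01 := congrFun (congrFun h1 0) 1
  have f11 := congrFun (congrFun h2 1) 1
  simp [Matrix.mul_apply, Fin.sum_univ_two, Matrix.star_apply] at e00 e01 f11
  refine ⟨e00, e01, ?_⟩
  have : ((‖B 0 0‖ ^ 2 : ℝ) : ℂ) = ((‖B 1 1‖ ^ 2 : ℝ) : ℂ) := by
    push_cast
    rw [← Complex.conj_mul', ← Complex.conj_mul']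
    linear_combination e00 - f11
  have h3 : ‖B 0 0‖ ^ 2 = ‖B 1 1‖ ^ 2 := by exact_mod_cast this
  exact (pow_left_inj₀ (norm_nonneg _) (norm_nonneg _) two_ne_zero).1 h3

/-- `a_B(ξ)` and `c_B(ξ)` are the only coefficients for which
`ψ_ξ = (a χ_{(-∞,0)} + χ_{(1,α)} + c χ_{(β,∞)}) e_ξ` satisfies the boundary condition
`B (ψ_ξ(1), ψ_ξ(β)) = (ψ_ξ(0), ψ_ξ(α))` that defines the domain of `P_B`. -/
theorem boundary_condition_iff (α β : ℝ) {B : Matrix (Fin 2) (Fin 2) ℂ}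
    (hB : B ∈ Matrix.unitaryGroup (Fin 2) ℂ) (h0 : B 0 0 ≠ 0) (ξ : ℝ) (a c : ℂ) :
    B.mulVec ![ePer (1 * ξ), c * ePer (β * ξ)] = ![a * ePer (0 * ξ), ePer (α * ξ)] ↔
      a = coeffA α B ξ ∧ c = coeffC α β B ξ := by
  obtain ⟨e00, e01, hn⟩ := unitary_entries hB
  have h1 : B 1 1 ≠ 0 := by rwa [← norm_ne_zero_iff, ← hn, norm_ne_zero_iff]
  have h0' : conj (B 0 0) ≠ 0 := by simpa using h0
  have E0 : ePer (0 * ξ) = 1 := by simp [ePer]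
  have E1 : ePer (-(β - α) * ξ) * ePer (β * ξ) = ePer (α * ξ) := by
    rw [← ePer_add]; congr 1; ring
  have E2 : ePer (-((α - 1) * ξ)) * ePer (α * ξ) = ePer ξ := by
    rw [← ePer_add]; congr 1; ring
  have E3 : ePer ξ * ePer ((α - 1) * ξ) = ePer (α * ξ) := by
    rw [← ePer_add]; congr 1; ring
  have hb := ePer_ne_zero (β * ξ)
  have hc : B 1 0 * ePer ξ + B 1 1 * (c * ePer (β * ξ)) = ePer (α * ξ) ↔
      c = coeffC α β B ξ := by
    have key : B 1 1 * coeffC α β B ξ * ePer (β * ξ) = ePer (α * ξ) - B 1 0 * ePer ξ := by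
      have : B 1 1 * (B 1 1)⁻¹ = 1 := mul_inv_cancel₀ h1
      rw [coeffC]
      linear_combination (ePer (-(β - α) * ξ) * (1 - B 1 0 * ePer (-((α - 1) * ξ))) *
        ePer (β * ξ)) * this + (1 - B 1 0 * ePer (-((α - 1) * ξ))) * E1 - B 1 0 * E2
    constructor
    · intro h
      apply mul_left_cancel₀ h1
      apply mul_right_cancel₀ hb
      linear_combination h - key
    · rintro rfl
      linear_combination key
  have ha : B 1 0 * ePer ξ + B 1 1 * (c * ePer (β * ξ)) = ePer (α * ξ) →
      (B 0 0 * ePer ξ + B 0 1 * (c * ePer (β * ξ)) = a ↔ a = coeffA α B ξ) := by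
    intro h
    have key : B 0 0 * ePer ξ + B 0 1 * (c * ePer (β * ξ)) = coeffA α B ξ := by
      apply mul_left_cancel₀ h0'
      have : conj (B 0 0) * (conj (B 0 0))⁻¹ = 1 := mul_inv_cancel₀ h0'
      rw [coeffA]
      linear_combination ePer ξ * e00 + (c * ePer (β * ξ)) * e01 - conj (B 1 0) * h
        - (ePer ξ * (1 - conj (B 1 0) * ePer ((α - 1) * ξ))) * this + conj (B 1 0) * E3
    rw [key]; exact eq_comm
  have hsys : B.mulVec ![ePer (1 * ξ), c * ePer (β * ξ)] = ![a * ePer (0 * ξ), ePer (α * ξ)] ↔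
      B 0 0 * ePer ξ + B 0 1 * (c * ePer (β * ξ)) = a ∧
      B 1 0 * ePer ξ + B 1 1 * (c * ePer (β * ξ)) = ePer (α * ξ) := by
    rw [E0, one_mul, mul_one, funext_iff, Fin.forall_fin_two]
    simp [Matrix.mulVec, dotProduct, Fin.sum_univ_two]
  rw [hsys, ← hc]
  constructor
  · rintro ⟨x, y⟩; exact ⟨(ha y).1 x, y⟩
  · rintro ⟨x, y⟩; exact ⟨(ha y).2 x, y⟩

theorem norm_coeffC (α β : ℝ) {B : Matrix (Fin 2) (Fin 2) ℂ}
    (hB : B ∈ Matrix.unitaryGroup (Fin 2) ℂ) (ξ : ℝ) : ‖coeffC α β B ξ‖ = mFun α B ξ := by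
  have h : conj (1 - B 1 0 * ePer (-((α - 1) * ξ))) =
      1 - conj (B 1 0) * ePer ((α - 1) * ξ) := by
    simp [conj_ePer]
  rw [mFun, coeffA, coeffC, ← h]
  simp only [norm_mul, norm_inv, RCLike.norm_conj, norm_ePer, (unitary_entries hB).2.2]

end

open scoped FourierTransform ENNReal

/-! A half-line in `Ω` already forces any pairing measure `μ` to be Lebesgue measure, and a gap in
`Ω` then rules that measure out. Rigidity (`IsSpectralPair.eq_volume`): moving `exp x` on the
negative half-line left by `t ≥ 0` keeps its support in `Ω` and multiplies its transform `1 / (1 +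
2πiξ)` by `e(-tξ)`. Preservation of inner products prescribes `∫ e(-tξ) / (1 + 4π²ξ²) dμ` for `t ≥
0`, hence by conjugation for all real `t`. These are the values of the characteristic function of a
finite measure, so `μ` is determined, and Lebesgue measure has the same values. Gap
(`not_isSpectralPair_volume`): for Lebesgue measure, the conjugate of `𝓕 g`, with `g` a bump in the
gap, is a nonzero element of `L²(ℝ)` orthogonal to the range, so the map is not onto. -/

theorem continuous_ePer : Continuous ePer := by
  unfold ePer; fun_prop

/-! ### Fourier integrals with kernel `e(ξx)` -/

theorem fourierInv_eq_integral_ePer (f : ℝ → ℂ) (w : ℝ) :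
    𝓕⁻ f w = ∫ v, f v * ePer (w * v) := by
  rw [Real.fourierInv_eq']
  refine integral_congr_ae (.of_forall fun v => ?_)
  simp only [ePer, smul_eq_mul, RCLike.inner_apply, conj_trivial]
  rw [mul_comm]
  congr 2
  push_cast
  ring

theorem fourier_eq_integral_ePer (f : ℝ → ℂ) (w : ℝ) :
    𝓕 f w = ∫ v, f v * ePer (-w * v) := by
  rw [← fourierInv_eq_integral_ePer, Real.fourierInv_eq_fourier_neg, neg_neg]

/-- The multiplication formula `∫ f̂ g = ∫ f ĝ`. -/
theorem integral_fourierInv_mul_eq_flip {f g : ℝ → ℂ} (hf : Integrable f) (hg : Integrable g) :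
    ∫ ξ, 𝓕⁻ f ξ * g ξ = ∫ x, f x * 𝓕⁻ g x := by
  -- The pairing `-xξ` turns the general forward transform into `𝓕⁻`.
  have hL : Continuous fun p : ℝ × ℝ => (-(LinearMap.mul ℝ ℝ)) p.1 p.2 := by
    simp only [LinearMap.neg_apply, LinearMap.mul_apply']
    fun_prop
  have h := VectorFourier.integral_fourierIntegral_smul_eq_flip (L := -(LinearMap.mul ℝ ℝ))
    Real.continuous_fourierChar hL hf hg
  have e1 (f : ℝ → ℂ) (ξ : ℝ) :
      VectorFourier.fourierIntegral Real.fourierChar volume (-(LinearMap.mul ℝ ℝ)) f ξ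
        = 𝓕⁻ f ξ := by
    simp [VectorFourier.fourierIntegral, Real.fourierInv_eq, mul_comm]
  have e2 (f : ℝ → ℂ) (ξ : ℝ) :
      VectorFourier.fourierIntegral Real.fourierChar volume (-(LinearMap.mul ℝ ℝ)).flip f ξ
        = 𝓕⁻ f ξ := by
    simp [VectorFourier.fourierIntegral, Real.fourierInv_eq]
  simpa only [e1, e2, smul_eq_mul] using h

/-! ### A gap contradicts surjectivity -/

/-- There is no isometric Fourier transform of `L²(Ω)` onto `L²(ℝ)` when `Ω` misses an interval. -/
theorem not_isSpectralPair_volume {Ω : Set ℝ} (hΩ : MeasurableSet Ω) {a b : ℝ} (hab : a < b)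
    (hd : Disjoint Ω (Set.Ioo a b)) : ¬ IsSpectralPair Ω volume := by
  rintro ⟨F, hF⟩
  let bump : ContDiffBump ((a + b) / 2) :=
    ⟨(b - a) / 4, (b - a) / 2, by linarith, by linarith⟩
  have hzero : ∀ x ∈ Ω, bump x = 0 := fun x hx => by
    refine bump.zero_of_le_dist ?_
    by_contra! h
    rw [Real.dist_eq, abs_lt] at h
    obtain ⟨h1, h2⟩ := h
    change _ < (b - a) / 2 at h2
    change -((b - a) / 2) < _ at h1
    exact Set.disjoint_left.1 hd hx ⟨by linarith, by linarith⟩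
  have hone : bump ((a + b) / 2) = 1 :=
    bump.one_of_mem_closedBall (Metric.mem_closedBall_self bump.rIn_pos.le)
  let g : ℝ → ℂ := fun x => (bump x : ℂ)
  have hgc : HasCompactSupport g := bump.hasCompactSupport.comp_left Complex.ofReal_zero
  have hgs : ContDiff ℝ (⊤ : ℕ∞) g := Complex.ofRealCLM.contDiff.comp bump.contDiff
  let G : SchwartzMap ℝ ℂ := hgc.toSchwartzMap hgs
  let φ : SchwartzMap ℝ ℂ := 𝓕 G
  have hφ : 𝓕⁻ (φ : ℝ → ℂ) = g := by
    rw [← SchwartzMap.fourierInv_coe, FourierTransform.fourierInv_fourier_eq]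
    rfl
  -- The conjugate cancels the one in the inner product, leaving the bilinear integral of the
  -- multiplication formula.
  have hΦm : MemLp (fun ξ => conj (φ ξ)) 2 (volume : Measure ℝ) := (φ.memLp 2 volume).star
  let Φ : Lp ℂ 2 (volume : Measure ℝ) := hΦm.toLp _
  have horth : ∀ f : Lp ℂ 2 (volume.restrict Ω), Integrable f (volume.restrict Ω) →
      inner ℂ (F f) Φ = 0 := by
    intro f hf
    rw [← inner_conj_symm, map_eq_zero, L2.inner_def]
    have hf' : Integrable (Ω.indicator f) := (integrable_indicator_iff hΩ).2 hf
    have hhat : ∀ ξ, ∫ x in Ω, f x * ePer (ξ * x) = 𝓕⁻ (Ω.indicator f) ξ := fun ξ => by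
      rw [fourierInv_eq_integral_ePer, ← integral_indicator hΩ]
      congr 1; ext x
      by_cases hx : x ∈ Ω <;> simp [hx]
    calc ∫ ξ, inner ℂ (Φ ξ) (F f ξ) = ∫ ξ, 𝓕⁻ (Ω.indicator f) ξ * φ ξ := by
          refine integral_congr_ae ?_
          filter_upwards [hF f hf, hΦm.coeFn_toLp] with ξ h1 h2
          rw [h1, h2, hhat]
          simp
      _ = ∫ x, Ω.indicator f x * 𝓕⁻ (φ : ℝ → ℂ) x :=
          integral_fourierInv_mul_eq_flip hf' φ.integrable
      _ = 0 := by
          rw [hφ]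
          refine integral_eq_zero_of_ae (.of_forall fun x => ?_)
          by_cases hx : x ∈ Ω
          · simp [g, hzero x hx]
          · simp [hx]
  -- Indicators of sets of finite measure are integrable, so the integral formula applies to them,
  -- and they suffice to detect zero.
  have h0 : F.symm Φ = 0 := by
    rw [Lp.eq_zero_iff_ae_eq_zero]
    refine Lp.ae_eq_zero_of_forall_setIntegral_eq_zero _ two_ne_zero ENNReal.ofNat_ne_top
      (fun s hs hμ => ?_) fun s hs hμ => ?_
    · exact integrableOn_Lp_of_measure_ne_top _ Fact.out hμ.ne
    · have := horth (indicatorConstLp 2 hs hμ.ne 1) (integrable_indicatorConstLp hs hμ.ne 1)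
      rwa [← F.apply_symm_apply Φ, F.inner_map_map, L2.inner_indicatorConstLp_one] at this
  have hΦ0 : Φ = 0 := by simpa using h0
  have hφ0 : (φ : ℝ → ℂ) =ᵐ[volume] 0 := by
    filter_upwards [hΦm.coeFn_toLp, (Lp.eq_zero_iff_ae_eq_zero.1 hΦ0)] with ξ h1 h2
    rw [h2] at h1
    simpa using h1.symm
  have : g ((a + b) / 2) = 0 := by
    rw [← hφ, Real.fourierInv_congr_ae hφ0, fourierInv_eq_integral_ePer]
    simp
  simp [g, hone] at this

/-! ### The Poisson weight determines a measure -/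

/-- The Fourier transform `ξ ↦ 1 / (1 + 2πiξ)` of `x ↦ exp x` on the negative half-line. -/
noncomputable def halfLineKernel (ξ : ℝ) : ℂ := (1 + 2 * Real.pi * Complex.I * ξ)⁻¹

theorem one_add_two_pi_I_mul_ne_zero (ξ : ℝ) : (1 + 2 * Real.pi * Complex.I * ξ : ℂ) ≠ 0 :=
  fun h => by simpa using congrArg Complex.re h

theorem halfLineKernel_ne_zero (ξ : ℝ) : halfLineKernel ξ ≠ 0 :=
  inv_ne_zero (one_add_two_pi_I_mul_ne_zero ξ)

theorem continuous_halfLineKernel : Continuous halfLineKernel :=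
  Continuous.inv₀ (by fun_prop) one_add_two_pi_I_mul_ne_zero

/-- The Poisson density `ξ ↦ 1 / (1 + 4π²ξ²)`. -/
noncomputable def poissonDensity (ξ : ℝ) : ℝ≥0 := ‖halfLineKernel ξ‖₊ ^ 2

theorem measurable_poissonDensity : Measurable poissonDensity :=
  (continuous_halfLineKernel.nnnorm.pow 2).measurable

theorem poissonDensity_ne_zero (ξ : ℝ) : poissonDensity ξ ≠ 0 :=
  pow_ne_zero 2 (nnnorm_ne_zero_iff.2 (halfLineKernel_ne_zero ξ))

theorem coe_poissonDensity (ξ : ℝ) :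
    (poissonDensity ξ : ℝ) = (1 + (2 * Real.pi * ξ) ^ 2)⁻¹ := by
  have : ‖(1 + 2 * Real.pi * Complex.I * ξ : ℂ)‖ ^ 2 = 1 + (2 * Real.pi * ξ) ^ 2 := by
    rw [← Complex.normSq_eq_norm_sq, Complex.normSq_apply]
    simp
    ring
  simp [poissonDensity, halfLineKernel, this]

theorem halfLineKernel_mul_conj (ξ : ℝ) :
    halfLineKernel ξ * conj (halfLineKernel ξ) = ((poissonDensity ξ : ℝ) : ℂ) := by
  rw [Complex.mul_conj, Complex.normSq_eq_norm_sq]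
  simp [poissonDensity]

theorem integrable_poissonDensity : Integrable fun ξ => (poissonDensity ξ : ℝ) := by
  simp only [coe_poissonDensity]
  exact integrable_inv_one_add_sq.comp_mul_left' (by positivity)

theorem isFiniteMeasure_withDensity_poissonDensity {μ : Measure ℝ}
    (h : Integrable (fun ξ => (poissonDensity ξ : ℝ)) μ) :
    IsFiniteMeasure (μ.withDensity fun ξ => (poissonDensity ξ : ℝ≥0∞)) := by
  simpa using isFiniteMeasure_withDensity_ofReal h.2

theorem charFun_withDensity_poissonDensity (μ : Measure ℝ) (t : ℝ) :
    charFun (μ.withDensity fun ξ => (poissonDensity ξ : ℝ≥0∞)) (-(2 * Real.pi * t)) =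
      ∫ ξ, ((poissonDensity ξ : ℝ) : ℂ) * ePer (-t * ξ) ∂μ := by
  rw [charFun_apply_real, integral_withDensity_eq_integral_smul measurable_poissonDensity]
  refine integral_congr_ae (.of_forall fun ξ => ?_)
  simp only [ePer, NNReal.smul_def, Complex.real_smul]
  congr 2
  push_cast
  ring

/-- Two measures with the same Poisson integrals of characters of one sign are equal. -/
theorem measure_eq_of_integral_poissonDensity {μ ν : Measure ℝ}
    (hμ : Integrable (fun ξ => (poissonDensity ξ : ℝ)) μ)
    (hν : Integrable (fun ξ => (poissonDensity ξ : ℝ)) ν)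
    (h : ∀ t, 0 ≤ t → ∫ ξ, ((poissonDensity ξ : ℝ) : ℂ) * ePer (-t * ξ) ∂μ =
      ∫ ξ, ((poissonDensity ξ : ℝ) : ℂ) * ePer (-t * ξ) ∂ν) : μ = ν := by
  have := isFiniteMeasure_withDensity_poissonDensity hμ
  have := isFiniteMeasure_withDensity_poissonDensity hν
  have hneg : ∀ s ≤ 0, charFun (μ.withDensity fun ξ => (poissonDensity ξ : ℝ≥0∞)) s =
      charFun (ν.withDensity fun ξ => (poissonDensity ξ : ℝ≥0∞)) s := by
    intro s hs
    have e : s = -(2 * Real.pi * (-s / (2 * Real.pi))) := by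
      field_simp
    rw [e, charFun_withDensity_poissonDensity, charFun_withDensity_poissonDensity]
    exact h _ (div_nonneg (by linarith) (by positivity))
  have key : μ.withDensity (fun ξ => (poissonDensity ξ : ℝ≥0∞)) =
      ν.withDensity fun ξ => (poissonDensity ξ : ℝ≥0∞) := by
    refine Measure.ext_of_charFun (funext fun s => ?_)
    rcases le_total s 0 with hs | hs
    · exact hneg s hs
    -- The other sign follows by conjugation, the measures being positive.
    · rw [← neg_neg s, charFun_neg, hneg (-s) (by linarith), ← charFun_neg]
  -- The weight is nowhere zero or infinite, so it can be divided out.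
  have inv (ρ : Measure ℝ) := withDensity_inv_same (μ := ρ)
    measurable_poissonDensity.coe_nnreal_ennreal
    (.of_forall fun ξ => by simpa using poissonDensity_ne_zero ξ)
    (.of_forall fun ξ => ENNReal.coe_ne_top)
  rw [← inv μ, key, inv ν]

/-! ### Explicit exponential integrals -/

/-- Used with `k = 1` for transforms of the test functions and with `k = 2`, `ξ = 0` for their inner
products. -/
theorem integral_exp_mul_ePer_Iio {k : ℝ} (hk : 0 < k) (t ξ : ℝ) :
    ∫ x in Set.Iio (-t), Complex.exp (k * x) * ePer (ξ * x) =
      Complex.exp (-(k * t)) * ePer (-t * ξ) / (k + 2 * Real.pi * Complex.I * ξ) := by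
  have hre : 0 < (k + 2 * Real.pi * Complex.I * ξ : ℂ).re := by simpa using hk
  rw [← integral_Iic_eq_integral_Iio]
  have e : ∀ x : ℝ, Complex.exp (k * x) * ePer (ξ * x) =
      Complex.exp ((k + 2 * Real.pi * Complex.I * ξ) * x) := fun x => by
    rw [ePer, ← Complex.exp_add]
    congr 1
    push_cast
    ring
  simp only [e]
  rw [integral_exp_mul_complex_Iic hre, ePer, ← Complex.exp_add]
  congr 2
  push_cast
  ring

theorem integral_exp_mul_ePer_Ioi (ξ : ℝ) :
    ∫ x in Set.Ioi (0 : ℝ), Complex.exp (-x) * ePer (ξ * x) =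
      1 / (1 - 2 * Real.pi * Complex.I * ξ) := by
  have hre : (-(1 - 2 * Real.pi * Complex.I * ξ) : ℂ).re < 0 := by simp
  have e : ∀ x : ℝ, Complex.exp (-x) * ePer (ξ * x) =
      Complex.exp (-(1 - 2 * Real.pi * Complex.I * ξ) * x) := fun x => by
    rw [ePer, ← Complex.exp_add]
    congr 1
    push_cast
    ring
  simp only [e]
  rw [integral_exp_mul_complex_Ioi hre]
  rw [Complex.ofReal_zero, mul_zero, Complex.exp_zero, neg_div_neg_eq]

theorem integrableOn_exp_Iio {k : ℝ} (hk : 0 < k) (c : ℝ) :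
    IntegrableOn (fun x : ℝ => Complex.exp (k * x)) (Set.Iio c) :=
  (integrableOn_exp_mul_complex_Iic (by simpa using hk) c).mono_set Set.Iio_subset_Iic_self

/-- The Poisson kernel as a Fourier transform. -/
theorem integral_poissonDensity_mul_ePer {t : ℝ} (ht : 0 ≤ t) :
    ∫ ξ, ((poissonDensity ξ : ℝ) : ℂ) * ePer (-t * ξ) = Complex.exp (-t) / 2 := by
  -- The transform of this function is the Poisson density; Fourier inversion then gives the claim.
  let f : ℝ → ℂ := fun x => Complex.exp (-|x|) / 2
  have hL : Set.EqOn f (fun x : ℝ => Complex.exp ((1 : ℝ) * x) / 2) (Set.Iic 0) := fun x hx => by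
    simp [f, abs_of_nonpos (Set.mem_Iic.1 hx)]
  have hR : Set.EqOn f (fun x : ℝ => Complex.exp (-1 * x) / 2) (Set.Ioi 0) := fun x hx => by
    simp [f, abs_of_pos (Set.mem_Ioi.1 hx)]
  have hfL : IntegrableOn f (Set.Iic 0) :=
    IntegrableOn.congr_fun ((integrableOn_exp_mul_complex_Iic (a := ((1 : ℝ) : ℂ)) (by simp) 0).div_const 2)
      hL.symm measurableSet_Iic
  have hfR : IntegrableOn f (Set.Ioi 0) :=
    IntegrableOn.congr_fun ((integrableOn_exp_mul_complex_Ioi (a := -1) (by simp) 0).div_const 2)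
      hR.symm measurableSet_Ioi
  have hfi : Integrable f := by
    rw [← integrableOn_univ, ← Set.Iic_union_Ioi (a := (0 : ℝ))]
    exact hfL.union hfR
  have hfc : Continuous f := by fun_prop
  have hmul (w : ℝ) : Integrable fun x => f x * ePer (w * x) :=
    hfi.mul_bdd (c := 1) (continuous_ePer.comp (by fun_prop)).aestronglyMeasurable
      (.of_forall fun x => (norm_ePer _).le)
  have hF : 𝓕⁻ f = fun ξ => ((poissonDensity ξ : ℝ) : ℂ) := by
    ext ξ
    rw [fourierInv_eq_integral_ePer, ← intervalIntegral.integral_Iic_add_Ioi (b := 0)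
      (hmul ξ).integrableOn (hmul ξ).integrableOn]
    have h1 : ∫ x in Set.Iic 0, f x * ePer (ξ * x) =
        (1 / 2) * ∫ x in Set.Iio (-0 : ℝ), Complex.exp ((1 : ℝ) * x) * ePer (ξ * x) := by
      rw [neg_zero, ← integral_Iic_eq_integral_Iio, ← integral_const_mul]
      refine setIntegral_congr_fun measurableSet_Iic fun x hx => ?_
      simp only [hL hx]
      ring
    have h2 : ∫ x in Set.Ioi 0, f x * ePer (ξ * x) =
        (1 / 2) * ∫ x in Set.Ioi (0 : ℝ), Complex.exp (-x) * ePer (ξ * x) := by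
      rw [← integral_const_mul]
      refine setIntegral_congr_fun measurableSet_Ioi fun x hx => ?_
      simp only [hR hx, neg_one_mul]
      ring
    rw [h1, h2, integral_exp_mul_ePer_Iio one_pos, integral_exp_mul_ePer_Ioi, coe_poissonDensity]
    have n1 := one_add_two_pi_I_mul_ne_zero ξ
    have n2 : (1 - 2 * Real.pi * Complex.I * ξ : ℂ) ≠ 0 := by
      simpa [sub_eq_add_neg] using one_add_two_pi_I_mul_ne_zero (-ξ)
    have n3 : (1 + 2 * Real.pi * Complex.I * ξ : ℂ) * (1 - 2 * Real.pi * Complex.I * ξ) =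
        1 + (2 * Real.pi * ξ) ^ 2 := by
      linear_combination (-(2 * Real.pi * ξ) ^ 2 : ℂ) * Complex.I_sq
    push_cast
    rw [← n3]
    simp only [ePer]
    field_simp
    simp
    ring
  have hinv : 𝓕 (𝓕⁻ f) = f := hfc.fourier_fourierInv_eq hfi (by
    have := (hF ▸ integrable_poissonDensity.ofReal : Integrable (𝓕⁻ f)).comp_neg
    simpa only [Real.fourierInv_eq_fourier_neg, neg_neg] using this)
  have := congrFun hinv t
  rw [hF, fourier_eq_integral_ePer] at this
  rw [this]
  simp [f, abs_of_nonneg ht]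

/-! ### Rigidity from the half-line -/

/-- If `Ω` contains the negative half-line, only Lebesgue measure can make it a spectral pair. -/
theorem IsSpectralPair.eq_volume {Ω : Set ℝ} (hneg : Set.Iio 0 ⊆ Ω)
    {μ : Measure ℝ} (h : IsSpectralPair Ω μ) : μ = volume := by
  obtain ⟨F, hF⟩ := h
  let f : ℝ → ℝ → ℂ := fun t => (Set.Iio (-t)).indicator fun x : ℝ => Complex.exp (x + t)
  have hsub {t : ℝ} (ht : 0 ≤ t) : Set.Iio (-t) ⊆ Ω :=
    (Set.Iio_subset_Iio (by linarith)).trans hneg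
  have hmeas (t : ℝ) : Measurable (f t) :=
    Measurable.indicator (by fun_prop) measurableSet_Iio
  have hint (t : ℝ) : Integrable (f t) := by
    rw [integrable_indicator_iff measurableSet_Iio]
    refine IntegrableOn.congr_fun ((integrableOn_exp_Iio one_pos (-t)).const_mul (Complex.exp t))
      (fun x _ => ?_) measurableSet_Iio
    simp [Complex.exp_add, mul_comm]
  have hbd (t x : ℝ) : ‖f t x‖ ≤ 1 := by
    by_cases hx : x ∈ Set.Iio (-t)
    · simp only [f, Set.indicator_of_mem hx, Complex.norm_exp]
      simp only [Set.mem_Iio] at hx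
      simp
      linarith
    · simp [f, Set.indicator_of_notMem hx]
  -- An integrable function bounded by 1 dominates its own square.
  have hL2 (t : ℝ) : MemLp (f t) 2 (volume.restrict Ω) := by
    refine MemLp.restrict Ω ?_
    refine (memLp_two_iff_integrable_sq_norm (hmeas t).aestronglyMeasurable).2 ?_
    refine (hint t).norm.mono' (by have := hmeas t; fun_prop) (.of_forall fun x => ?_)
    rw [Real.norm_of_nonneg (by positivity)]
    nlinarith [hbd t x, norm_nonneg (f t x)]
  let u : ℝ → Lp ℂ 2 (volume.restrict Ω) := fun t => (hL2 t).toLp (f t)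
  have hu (t : ℝ) : u t =ᵐ[volume.restrict Ω] f t := (hL2 t).coeFn_toLp
  have hset (t : ℝ) (ht : 0 ≤ t) (g : ℝ → ℂ) : ∫ x in Ω, f t x * g x =
      ∫ x in Set.Iio (-t), Complex.exp (x + t) * g x := by
    have : (fun x => f t x * g x) =
        (Set.Iio (-t)).indicator fun x => Complex.exp (x + t) * g x := by
      ext x
      by_cases hx : x ∈ Set.Iio (-t) <;> simp [f, hx]
    rw [this, setIntegral_indicator measurableSet_Iio, Set.inter_eq_right.2 (hsub ht)]
  have hFu (t : ℝ) (ht : 0 ≤ t) : F (u t) =ᵐ[μ] fun ξ => ePer (-t * ξ) * halfLineKernel ξ := by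
    refine (hF (u t) ((hint t).restrict.congr (hu t).symm)).trans (.of_forall fun ξ => ?_)
    have h1 : ∫ x in Ω, u t x * ePer (ξ * x) = ∫ x in Ω, f t x * ePer (ξ * x) :=
      integral_congr_ae ((hu t).mono fun x hx => by simp only [hx])
    simp only [h1, hset t ht]
    have h2 : ∀ x : ℝ, Complex.exp (x + t) * ePer (ξ * x) =
        Complex.exp t * (Complex.exp ((1 : ℝ) * x) * ePer (ξ * x)) := fun x => by
      rw [Complex.exp_add]; simp only [Complex.ofReal_one, one_mul]; ring
    simp only [h2]
    rw [integral_const_mul, integral_exp_mul_ePer_Iio one_pos, halfLineKernel]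
    simp only [Complex.ofReal_one, one_mul]
    rw [div_eq_mul_inv, ← mul_assoc, ← mul_assoc, ← Complex.exp_add]
    simp
  have hinner (t : ℝ) (ht : 0 ≤ t) : inner ℂ (u 0) (u t) = Complex.exp (-t) / 2 := by
    rw [L2.inner_def]
    calc ∫ x in Ω, inner ℂ (u 0 x) (u t x) = ∫ x in Ω, f t x * conj (f 0 x) := by
          refine integral_congr_ae ?_
          filter_upwards [hu 0, hu t] with x h0 h1
          rw [h0, h1]
          simp
      _ = ∫ x in Set.Iio (-t), Complex.exp (x + t) * conj (f 0 x) := hset t ht _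
      _ = ∫ x in Set.Iio (-t), Complex.exp t * (Complex.exp ((2 : ℝ) * x) * ePer (0 * x)) := by
          refine setIntegral_congr_fun measurableSet_Iio fun x hx => ?_
          have hx0 : x < 0 := lt_of_lt_of_le hx (by linarith)
          simp only [f, ePer, neg_zero, Set.indicator_of_mem (Set.mem_Iio.2 hx0),
            ← Complex.exp_conj, ← Complex.exp_add]
          congr 1
          simp
          ring
      _ = Complex.exp (-t) / 2 := by
          rw [integral_const_mul, integral_exp_mul_ePer_Iio two_pos]
          simp only [ePer, mul_zero, Complex.ofReal_zero, Complex.exp_zero, mul_one, add_zero]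
          rw [← mul_div_assoc, ← Complex.exp_add]
          congr 2
          push_cast
          ring
  have hFinner (t : ℝ) (ht : 0 ≤ t) : inner ℂ (F (u 0)) (F (u t)) =
      ∫ ξ, ((poissonDensity ξ : ℝ) : ℂ) * ePer (-t * ξ) ∂μ := by
    rw [L2.inner_def]
    refine integral_congr_ae ?_
    filter_upwards [hFu 0 le_rfl, hFu t ht] with ξ h0 h1
    rw [h0, h1, ← halfLineKernel_mul_conj]
    simp [ePer]
    ring
  -- The weight is `|F (u 0)|²`, integrable because `F (u 0)` lies in `L²(μ)`.
  have hfin : Integrable (fun ξ => (poissonDensity ξ : ℝ)) μ := by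
    have := (memLp_two_iff_integrable_sq_norm (Lp.aestronglyMeasurable _)).1 (Lp.memLp (F (u 0)))
    refine this.congr ((hFu 0 le_rfl).mono fun ξ hξ => ?_)
    simp only [hξ]
    simp [poissonDensity, norm_ePer]
  refine measure_eq_of_integral_poissonDensity hfin integrable_poissonDensity fun t ht => ?_
  rw [← hFinner t ht, F.inner_map_map, hinner t ht, integral_poissonDensity_mul_ePer ht]

theorem proposition3p23 (α β : ℝ) (hα : 1 < α) (hβ : α < β) (κ : ℝ≥0) (hκ : 0 < κ) :
    ¬ ∃ B : Matrix (Fin 2) (Fin 2) ℂ, B ∈ Matrix.unitaryGroup (Fin 2) ℂ ∧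
      IsSpectralPair (exteriorDomain α β) (sigmaMeasure α κ B) := by
  rintro ⟨B, -, hB⟩
  have hm : MeasurableSet (exteriorDomain α β) :=
    (measurableSet_Iio.union measurableSet_Ioo).union measurableSet_Ioi
  have hv := hB.eq_volume fun x hx => Or.inl (Or.inl hx)
  rw [hv] at hB
  -- The gap used is `(0, 1)`.
  refine not_isSpectralPair_volume hm one_pos (Set.disjoint_left.2 ?_) hB
  rintro x ((hx | hx) | hx) ⟨h1, h2⟩
  · exact lt_asymm h1 hx
  · exact lt_asymm h2 hx.1
  · have : β < x := hx
    linarith
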